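/- A \emph{Gödel algebra} is a Heyting algebra $A$ with $(a\to b)\vee(b\to a)=\mathbf 1$ for all $a,b\in A$. For a Heyting algebra $A$ let $Hom(A,\{0,1\})$ be the set of bounded lattice homomorphisms $A\to\{0,1\}$, ordered pointwise. A \emph{Gödel algebraic I-topological system} is a triple $(X,\models,A)$ consisting of a nonempty set $X$, a Gödel algebra $A$ and a relation $\models$ from $X$ to $A$ such that, for all $x\in X$ and $a,b\in A$, with $p^*(x):A\to\{0,1\}$ defined by $p^*(x)(a)=1$ iff $x\models a$: (1) $x\not\models\mathbf 0$; (2) $x\models a\wedge b$ iff $x\models a$ and $x\models b$; (3) $x\models a\vee b$ iff $x\models a$ or $x\models b$; (4) $x\models a\to b$ iff for every $y\in X$ with $p^*(x)\le p^*(y)$ pointwise, $y\not\models a$ or $y\models b$; (5) $p^*$ is a bijection from $X$ onto $Hom(A,\{0,1\})$. A morphism $(X,\models,A)\to(Y,\models',B)$ is a pair $(f_1,f_2)$ of a map $f_1:X\to Y$ and a Heyting homomorphism $f_2:B\to A$ such that $x\models f_2(b)$ iff $f_1(x)\models' b$ for all $x\in X$, $b\in B$; composition is $(g_1,g_2)\circ(f_1,f_2)=(g_1\circ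 f_1,f_2\circ g_2)$. These form the category $\mathbf{GI\text{-}TopSys}$. An \emph{Esakia space} is a compact partially ordered topological space $(X,\le,\tau)$ such that whenever $x\not\le y$ there is a clopen up-set containing $x$ but not $y$, and such that the down-set $\downarrow U$ of every clopen set $U$ is clopen. An \emph{Esakia morphism} is a continuous order-preserving map $f$ such that whenever $f(x)\le y$ there is $z\ge x$ with $f(z)=y$. Let $\mathbf{FESA}$ be the category of nonempty Esakia spaces whose order is a forest, meaning that for each point $x$ the set $\{y: x\le y\}$ is a chain, with all Esakia morphisms between them. \textbf{Theorem.} The categories $\mathbf{GI\text{-}TopSys}$ and $\mathbf{FESA}$ are equivalent. -/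

import Mathlib

open CategoryTheory

universe u

noncomputable section

/-! ### I-topological systems -/

open scoped Classical in
/-- The characteristic function `p^*(x) : A → {0,1}` of a point `x`, for a relation `⊨` from `X`
to `A`: `p^*(x)(a) = 1` iff `x ⊨ a`. -/
def satChar {X A : Type u} (sat : X → A → Prop) (x : X) : A → Bool :=
  fun a => decide (sat x a)

/-- An I-topological system `(X, ⊨, A)`: a nonempty set, a Heyting algebra and a satisfaction
relation. The relation `R` on `{0,1}`-valued maps is the pointwise order. -/
structure ITopSys : Type (u + 1) where
  /-- the points -/
  X : Type u
  /-- the Heyting algebra -/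
  A : Type u
  [nonemptyX : Nonempty X]
  [heyting : HeytingAlgebra A]
  /-- the relation `x ⊨ a` -/
  sat : X → A → Prop
  not_sat_bot : ∀ x, ¬ sat x ⊥
  sat_inf : ∀ x a b, sat x (a ⊓ b) ↔ sat x a ∧ sat x b
  sat_sup : ∀ x a b, sat x (a ⊔ b) ↔ sat x a ∨ sat x b
  sat_himp : ∀ x a b, sat x (a ⇨ b) ↔
    ∀ y, satChar sat x ≤ satChar sat y → (¬ sat y a ∨ sat y b)

namespace ITopSys

attribute [instance] ITopSys.nonemptyX ITopSys.heyting

theorem sat_top (S : ITopSys.{u}) (x : S.X) : S.sat x ⊤ := by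
  have h := (S.sat_himp x ⊥ ⊥).2 (fun y _ => Or.inl (S.not_sat_bot y))
  rwa [himp_self] at h

/-- The map `p^* : X → Hom(A, {0,1})` into the set of bounded lattice homomorphisms, with
`p^*(x)(a) = 1` iff `x ⊨ a`. -/
def pStar (S : ITopSys.{u}) (x : S.X) : BoundedLatticeHom S.A Bool where
  toFun := satChar S.sat x
  map_sup' a b := by rw [Bool.eq_iff_iff]; simp [satChar, S.sat_sup]
  map_inf' a b := by rw [Bool.eq_iff_iff]; simp [satChar, S.sat_inf]
  map_top' := by simp [satChar, S.sat_top]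
  map_bot' := by simp [satChar, S.not_sat_bot]

theorem pStar_apply_eq_true (S : ITopSys.{u}) (x : S.X) (a : S.A) :
    S.pStar x a = true ↔ S.sat x a := by
  change satChar S.sat x a = true ↔ _
  simp [satChar]

/-- Morphisms `(f₁, f₂) : (X, ⊨, A) → (Y, ⊨', B)` of I-topological systems. -/
@[ext]
structure Hom (S T : ITopSys.{u}) : Type u where
  /-- the map of points -/
  f₁ : S.X → T.X
  /-- the Heyting homomorphism, in the opposite direction -/
  f₂ : HeytingHom T.A S.A
  sat_iff : ∀ (x : S.X) (b : T.A), S.sat x (f₂ b) ↔ T.sat (f₁ x) b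

/-- The category **I-TopSys**. -/
instance : Category.{u} ITopSys.{u} where
  Hom S T := Hom S T
  id S := { f₁ := id, f₂ := HeytingHom.id S.A, sat_iff := fun _ _ => Iff.rfl }
  comp f g :=
    { f₁ := g.f₁ ∘ f.f₁
      f₂ := f.f₂.comp g.f₂
      sat_iff := fun x c => (f.sat_iff x (g.f₂ c)).trans (g.sat_iff (f.f₁ x) c) }

/-- An I-topological system is Gödel algebraic if its algebra is a Gödel algebra (a prelinear
Heyting algebra) and `p^*` is a bijection onto the set of all bounded lattice homomorphisms
`A → {0,1}`. -/
def IsGodelAlgebraic : ObjectProperty ITopSys.{u} := fun S =>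
  (∀ a b : S.A, (a ⇨ b) ⊔ (b ⇨ a) = ⊤) ∧ Function.Bijective S.pStar

end ITopSys

/-- The category **GI-TopSys** of Gödel algebraic I-topological systems, with all morphisms of
I-topological systems between them. -/
abbrev GITopSys : Type (u + 1) := ITopSys.IsGodelAlgebraic.{u}.FullSubcategory

/-! ### Esakia spaces -/

/-- A (bundled) Esakia space: a compact partially ordered space satisfying the Priestley
separation axiom in which the down-set of every clopen set is clopen. -/
structure EsakiaSpace : Type (u + 1) where
  /-- the points -/
  X : Type u
  [top : TopologicalSpace X]
  [order : PartialOrder X]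
  [compact : CompactSpace X]
  [priestley : PriestleySpace X]
  isClopen_lowerClosure : ∀ U : Set X, IsClopen U → IsClopen (lowerClosure U : Set X)

namespace EsakiaSpace

attribute [instance] EsakiaSpace.top EsakiaSpace.order EsakiaSpace.compact
  EsakiaSpace.priestley

/-- The category **ESA** of Esakia spaces and Esakia morphisms (continuous p-morphisms). -/
instance : Category.{u} EsakiaSpace.{u} where
  Hom S T := EsakiaHom S.X T.X
  id S := EsakiaHom.id S.X
  comp f g := EsakiaHom.comp g f

/-- The space is nonempty and its order is a forest: the points above any given point form a
chain. -/
def IsForest : ObjectProperty EsakiaSpace.{u} := fun S =>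
  Nonempty S.X ∧ ∀ x : S.X, IsChain (· ≤ ·) (Set.Ici x)

end EsakiaSpace

/-- The category **FESA** of nonempty Esakia spaces whose order is a forest, with all Esakia
morphisms between them. -/
abbrev FESA : Type (u + 1) := EsakiaSpace.IsForest.{u}.FullSubcategory

end

open Topology

noncomputable section

/-! ### The Esakia space of points of a system -/

namespace ITopSys

variable (S : ITopSys.{u})

/-! This is Esakia duality with the algebra carried along. The points, viewed through `p^*` inside
the cube `{0,1}^A`, are exactly the homomorphisms, a closed and hence compact set; the clause for
`→` makes down-sets of clopens clopen, and prelinearity makes the order a forest. Forgetting the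
algebra gives a functor. It is faithful since an element is determined by its extent (prime ideal
theorem), full since every clopen up-set is an extent, and essentially surjective since every
homomorphism on clopen up-sets is evaluation at a point (compactness). -/

/-- The topology on the points making `p^*` an embedding into the Cantor cube. -/
instance : TopologicalSpace S.X := TopologicalSpace.induced (satChar S.sat) inferInstance

/-- The specialization order: `x ≤ y` iff `p^*(x) ≤ p^*(y)`. -/
instance : Preorder S.X := Preorder.lift (satChar S.sat)

variable {S}

theorem le_iff_satChar {x y : S.X} : x ≤ y ↔ satChar S.sat x ≤ satChar S.sat y := Iff.rfl

theorem le_iff_sat {x y : S.X} : x ≤ y ↔ ∀ a, S.sat x a → S.sat y a := by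
  rw [le_iff_satChar, Pi.le_def]
  refine forall_congr' fun a => ?_
  rw [Bool.le_iff_imp]
  simp [satChar]

theorem sat_himp_iff {x : S.X} {a b : S.A} :
    S.sat x (a ⇨ b) ↔ ∀ y, x ≤ y → S.sat y a → S.sat y b := by
  rw [S.sat_himp]
  simp only [le_iff_satChar, imp_iff_not_or]

theorem isClopen_setOf_sat (a : S.A) : IsClopen {x : S.X | S.sat x a} := by
  have h : Continuous fun x : S.X => satChar S.sat x a :=
    (continuous_apply (A := fun _ : S.A => Bool) a).comp
      (continuous_induced_dom (f := satChar S.sat))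
  have h' := (isClopen_discrete ({true} : Set Bool)).preimage h
  convert h' using 1
  ext x
  simp [satChar]

/-- A basic neighbourhood fixes finitely many coordinates: the satisfied ones are met into `a`, the
failing ones joined into `b`. -/
theorem exists_sat_not_sat_subset {x : S.X} {U : Set S.X} (hU : IsOpen U) (hx : x ∈ U) :
    ∃ a b, S.sat x a ∧ ¬ S.sat x b ∧ ∀ y, S.sat y a → ¬ S.sat y b → y ∈ U := by
  obtain ⟨V, hV, rfl⟩ := isOpen_induced_iff.1 hU
  obtain ⟨I, u, hu, hI⟩ := isOpen_pi_iff.1 hV _ hx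
  have key : ∃ a b, S.sat x a ∧ ¬ S.sat x b ∧ ∀ y, S.sat y a → ¬ S.sat y b →
      ∀ i ∈ I, (S.sat y i ↔ S.sat x i) := by
    clear hI hu
    induction I using Finset.cons_induction with
    | empty => exact ⟨⊤, ⊥, S.sat_top x, S.not_sat_bot x, by simp⟩
    | cons i I hi ih =>
      obtain ⟨a, b, ha, hb, h⟩ := ih
      by_cases hxi : S.sat x i
      · refine ⟨a ⊓ i, b, (S.sat_inf ..).2 ⟨ha, hxi⟩, hb, fun y hy hy' j hj => ?_⟩
        rw [S.sat_inf] at hy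
        rcases Finset.mem_cons.1 hj with rfl | hj
        · simp [hxi, hy.2]
        · exact h y hy.1 hy' j hj
      · refine ⟨a, b ⊔ i, ha, by simp [S.sat_sup, hb, hxi], fun y hy hy' j hj => ?_⟩
        rw [S.sat_sup, not_or] at hy'
        rcases Finset.mem_cons.1 hj with rfl | hj
        · simp [hxi, hy'.2]
        · exact h y hy hy'.1 j hj
  obtain ⟨a, b, ha, hb, h⟩ := key
  refine ⟨a, b, ha, hb, fun y hy hy' => hI fun i hi => ?_⟩
  have hyx : satChar S.sat y i = satChar S.sat x i := by simp [satChar, h y hy hy' i hi]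
  rw [hyx]
  exact (hu i hi).2

instance : PriestleySpace S.X where
  priestley {x y} h := by
    simp only [le_iff_sat, not_forall] at h
    obtain ⟨a, hx, hy⟩ := h
    exact ⟨_, isClopen_setOf_sat a, fun _ _ hle ha => le_iff_sat.1 hle a ha, hx, hy⟩

namespace IsGodelAlgebraic

theorem le_antisymm (hS : S.IsGodelAlgebraic) {x y : S.X} (h : x ≤ y) (h' : y ≤ x) : x = y :=
  hS.2.1 (DFunLike.coe_injective (_root_.le_antisymm (α := S.A → Bool) h h'))

theorem range_satChar (hS : S.IsGodelAlgebraic) : Set.range (satChar S.sat) =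
    {h | h ⊤ = true ∧ h ⊥ = false ∧ (∀ a b, h (a ⊔ b) = (h a || h b)) ∧
      ∀ a b, h (a ⊓ b) = (h a && h b)} := by
  ext h
  constructor
  · rintro ⟨x, rfl⟩
    exact ⟨map_top (S.pStar x), map_bot (S.pStar x), map_sup (S.pStar x), map_inf (S.pStar x)⟩
  · rintro ⟨h₁, h₀, hsup, hinf⟩
    obtain ⟨x, hx⟩ := hS.2.2
      { toFun := h, map_sup' := hsup, map_inf' := hinf, map_top' := h₁, map_bot' := h₀ }
    exact ⟨x, congrArg DFunLike.coe hx⟩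

theorem compactSpace (hS : S.IsGodelAlgebraic) : CompactSpace S.X := by
  have hind : IsInducing (satChar S.sat) := ⟨rfl⟩
  rw [← isCompact_univ_iff, hind.isCompact_iff, Set.image_univ, hS.range_satChar]
  apply IsClosed.isCompact
  have hc (a : S.A) : Continuous fun h : S.A → Bool => h a := continuous_apply a
  simp only [Set.ofPred_and, Set.ofPred_forall]
  refine (isClosed_eq (hc _) continuous_const).inter
    ((isClosed_eq (hc _) continuous_const).inter (IsClosed.inter ?_ ?_)) <;>
  · refine isClosed_iInter fun a => isClosed_iInter fun b => isClosed_eq (hc _) ?_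
    first
    | exact (continuous_of_discreteTopology (f := fun p : Bool × Bool => (p.1 || p.2))).comp
        ((hc a).prodMk (hc b))
    | exact (continuous_of_discreteTopology (f := fun p : Bool × Bool => (p.1 && p.2))).comp
        ((hc a).prodMk (hc b))

/-- The complement of the down-set of a clopen set is the extent of an element. -/
theorem exists_sat_iff_forall_notMem (hS : S.IsGodelAlgebraic) {U : Set S.X} (hU : IsClopen U) :
    ∃ a, ∀ x, S.sat x a ↔ ∀ y, x ≤ y → y ∉ U := by
  have := hS.compactSpace
  -- Splitting the equivalence lets the first half vary with a piece `s` of `U` while the second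
  -- keeps `U` fixed, so that the property passes to subsets and to unions.
  suffices h : ∃ a, ∀ x, (S.sat x a → ∀ y, x ≤ y → y ∉ U) ∧
      ((∀ y, x ≤ y → y ∉ U) → S.sat x a) from
    h.imp fun a ha x => ⟨(ha x).1, (ha x).2⟩
  refine hU.1.isCompact.induction_on
    (p := fun s => ∃ a, ∀ x, (S.sat x a → ∀ y, x ≤ y → y ∉ s) ∧
      ((∀ y, x ≤ y → y ∉ U) → S.sat x a)) ?_ ?_ ?_ ?_
  · exact ⟨⊤, fun x => ⟨by simp, fun _ => S.sat_top x⟩⟩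
  · rintro s t hst ⟨a, ha⟩
    exact ⟨a, fun x => ⟨fun h y hy hys => (ha x).1 h y hy (hst hys), (ha x).2⟩⟩
  · rintro s t ⟨a, ha⟩ ⟨b, hb⟩
    refine ⟨a ⊓ b, fun x => ⟨fun h y hy => ?_, fun h => ?_⟩⟩
    · rw [S.sat_inf] at h
      exact not_or.2 ⟨(ha x).1 h.1 y hy, (hb x).1 h.2 y hy⟩
    · exact (S.sat_inf ..).2 ⟨(ha x).2 h, (hb x).2 h⟩
  · intro x hx
    obtain ⟨b, c, hb, hc, hbc⟩ := exists_sat_not_sat_subset hU.2 hx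
    refine ⟨{y | S.sat y b} ∩ {y | S.sat y c}ᶜ, mem_nhdsWithin_of_mem_nhds
      (((isClopen_setOf_sat b).inter (isClopen_setOf_sat c).compl).2.mem_nhds ⟨hb, hc⟩),
      b ⇨ c, fun z => ⟨fun h y hy hys => ?_, fun h => ?_⟩⟩
    · exact hys.2 (sat_himp_iff.1 h y hy hys.1)
    · rw [sat_himp_iff]
      intro y hy hyb
      by_contra hyc
      exact h y hy (hbc y hyb hyc)

theorem isClopen_lowerClosure (hS : S.IsGodelAlgebraic) {U : Set S.X} (hU : IsClopen U) :
    IsClopen (lowerClosure U : Set S.X) := by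
  obtain ⟨a, ha⟩ := hS.exists_sat_iff_forall_notMem hU
  convert (isClopen_setOf_sat a).compl using 1
  ext x
  simp only [SetLike.mem_coe, mem_lowerClosure, Set.mem_compl_iff, Set.mem_ofPred_eq, ha]
  push Not
  exact exists_congr fun y => and_comm

theorem exists_sat_iff_mem (hS : S.IsGodelAlgebraic) {U : Set S.X} (hU : IsClopen U)
    (hU' : IsUpperSet U) : ∃ a, ∀ x, S.sat x a ↔ x ∈ U := by
  obtain ⟨a, ha⟩ := hS.exists_sat_iff_forall_notMem hU.compl
  refine ⟨a, fun x => (ha x).trans ⟨fun h => ?_, fun h y hy hyU => hyU (hU' hy h)⟩⟩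
  simpa using h x le_rfl

/-- Incomparable successors of `x` would refute `a ⇨ b` and `b ⇨ a` at `x`, for elements `a`, `b`
separating them. -/
theorem isChain_Ici (hS : S.IsGodelAlgebraic) (x : S.X) : IsChain (· ≤ ·) (Set.Ici x) := by
  intro y hy z hz _
  by_contra h
  rw [not_or] at h
  simp only [le_iff_sat, not_forall] at h
  obtain ⟨⟨a, hya, hza⟩, b, hzb, hyb⟩ := h
  have hx := S.sat_top x
  rw [← hS.1 a b, S.sat_sup] at hx
  rcases hx with hx | hx
  · exact hyb (sat_himp_iff.1 hx y hy hya)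
  · exact hza (sat_himp_iff.1 hx z hz hzb)

theorem le_of_forall_sat (hS : S.IsGodelAlgebraic) {a b : S.A}
    (h : ∀ x, S.sat x a → S.sat x b) : a ≤ b := by
  classical
  by_contra hab
  have hd : Disjoint (Order.PFilter.principal a : Set S.A)
      (Order.Ideal.principal b : Set S.A) := by
    refine Set.disjoint_left.2 fun c hc hc' => hab ?_
    exact (Order.PFilter.mem_principal.1 hc).trans (Order.Ideal.mem_principal.1 hc')
  obtain ⟨J, hJ, hbJ, haJ⟩ := DistribLattice.prime_ideal_of_disjoint_filter_ideal hd
  -- Surjectivity of `p^*` turns the complement of the prime ideal into a point.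
  obtain ⟨x, hx⟩ := hS.2.2
    { toFun := fun c => decide (c ∉ J)
      map_sup' := fun c d => by rw [Bool.eq_iff_iff]; simp [imp_iff_not_or]
      map_inf' := fun c d => by
        have : c ⊓ d ∈ J ↔ c ∈ J ∨ d ∈ J :=
          ⟨hJ.mem_or_mem, fun h => h.elim (J.lower inf_le_left) (J.lower inf_le_right)⟩
        rw [Bool.eq_iff_iff]; simp [this]
      map_top' := by simpa using hJ.toIsProper.top_notMem
      map_bot' := by simp }
  have hsat (c : S.A) : S.sat x c ↔ c ∉ J := by
    rw [← S.pStar_apply_eq_true, hx]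
    exact decide_eq_true_iff
  refine (hsat b).1 (h x ((hsat a).2 ?_)) (hbJ (Order.Ideal.mem_principal.2 le_rfl))
  exact Set.disjoint_left.1 haJ (Order.PFilter.mem_principal.2 le_rfl)

theorem eq_of_forall_sat_iff (hS : S.IsGodelAlgebraic) {a b : S.A}
    (h : ∀ x, S.sat x a ↔ S.sat x b) : a = b :=
  _root_.le_antisymm (hS.le_of_forall_sat fun x => (h x).1) (hS.le_of_forall_sat fun x => (h x).2)

/-- The Esakia space of points of a Gödel algebraic I-topological system. -/
def toEsakiaSpace (hS : S.IsGodelAlgebraic) : EsakiaSpace.{u} where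
  X := S.X
  order := { (inferInstance : Preorder S.X) with le_antisymm := fun _ _ => hS.le_antisymm }
  compact := hS.compactSpace
  priestley := inferInstanceAs (PriestleySpace S.X)
  isClopen_lowerClosure _ hU := hS.isClopen_lowerClosure hU

theorem isForest_toEsakiaSpace (hS : S.IsGodelAlgebraic) : hS.toEsakiaSpace.IsForest :=
  ⟨S.nonemptyX, hS.isChain_Ici⟩

end IsGodelAlgebraic

/-! ### Morphisms of systems as Esakia morphisms -/

namespace Hom

variable {T : ITopSys.{u}}

theorem monotone (f : Hom S T) : Monotone f.f₁ := fun x y h => by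
  rw [le_iff_sat] at h ⊢
  intro a
  rw [← f.sat_iff, ← f.sat_iff]
  exact h _

theorem continuous (f : Hom S T) : Continuous f.f₁ := by
  refine continuous_def.2 fun U hU => isOpen_iff_mem_nhds.2 fun x hx => ?_
  obtain ⟨a, b, ha, hb, hab⟩ := exists_sat_not_sat_subset hU hx
  rw [← f.sat_iff] at ha hb
  filter_upwards [((isClopen_setOf_sat (f.f₂ a)).inter
    (isClopen_setOf_sat (f.f₂ b)).compl).2.mem_nhds ⟨ha, hb⟩] with y hy
  exact hab _ ((f.sat_iff y a).1 hy.1) fun h => hy.2 ((f.sat_iff y b).2 h)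

/-- The image of the up-set of `x` is compact, hence closed. A missed `y` would be separated from it
by some `a`, `b`; then `x` satisfies `f₂ (a ⇨ b)`, which `y` contradicts. -/
theorem exists_map_eq_of_map_le (f : Hom S T) (hS : S.IsGodelAlgebraic)
    (hT : T.IsGodelAlgebraic) {x : S.X} {y : T.X} (h : f.f₁ x ≤ y) :
    ∃ z, x ≤ z ∧ f.f₁ z = y := by
  have := hS.compactSpace
  let F := hT.toEsakiaSpace
  have hcl : IsClosed (Set.Ici x) := by
    have : Set.Ici x = ⋂ a, ⋂ _ : S.sat x a, {z | S.sat z a} := by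
      ext z
      simp [le_iff_sat]
    rw [this]
    exact isClosed_iInter fun a => isClosed_iInter fun _ => (isClopen_setOf_sat a).1
  have : T2Space T.X := inferInstanceAs (T2Space F.X)
  have himg : IsClosed (f.f₁ '' Set.Ici x) := (hcl.isCompact.image f.continuous).isClosed
  by_contra hy
  obtain ⟨a, b, ha, hb, hab⟩ := exists_sat_not_sat_subset (x := y) himg.isOpen_compl
    fun ⟨z, hz, hzy⟩ => hy ⟨z, hz, hzy⟩
  have hx : S.sat x (f.f₂ (a ⇨ b)) := by
    rw [map_himp, sat_himp_iff]
    intro z hz hza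
    by_contra hzb
    rw [f.sat_iff] at hza hzb
    exact hab _ hza hzb ⟨z, hz, rfl⟩
  exact hb (sat_himp_iff.1 ((f.sat_iff x _).1 hx) y h ha)

/-- The Esakia morphism underlying a morphism of Gödel algebraic I-topological systems. -/
def toEsakiaHom (f : Hom S T) (hS : S.IsGodelAlgebraic) (hT : T.IsGodelAlgebraic) :
    hS.toEsakiaSpace ⟶ hT.toEsakiaSpace :=
  show EsakiaHom hS.toEsakiaSpace.X hT.toEsakiaSpace.X from
  { toFun := f.f₁
    monotone' := f.monotone
    continuous_toFun := f.continuous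
    exists_map_eq_of_map_le' := fun _ _ h => f.exists_map_eq_of_map_le hS hT h }

theorem ext_of_f₁_eq {f g : Hom S T} (hS : S.IsGodelAlgebraic) (h : f.f₁ = g.f₁) : f = g := by
  refine Hom.ext h (DFunLike.ext _ _ fun b => hS.eq_of_forall_sat_iff fun x => ?_)
  rw [f.sat_iff, g.sat_iff, h]

/-- The preimage of an extent is a clopen up-set, hence an extent, which defines `f₂`; the lifting
condition `hp` serves only to preserve `⇨`. -/
theorem exists_of_continuous (hS : S.IsGodelAlgebraic) (g : S.X → T.X) (hc : Continuous g)
    (hm : Monotone g) (hp : ∀ ⦃x y⦄, g x ≤ y → ∃ z, x ≤ z ∧ g z = y) :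
    ∃ f : Hom S T, f.f₁ = g := by
  have key (b : T.A) : ∃ a, ∀ x, S.sat x a ↔ T.sat (g x) b :=
    hS.exists_sat_iff_mem ((isClopen_setOf_sat b).preimage hc)
      fun x y hxy hx => le_iff_sat.1 (hm hxy) b hx
  choose φ hφ using key
  refine ⟨⟨g, { toFun := φ, map_sup' := ?_, map_inf' := ?_, map_bot' := ?_, map_himp' := ?_ },
    fun x b => hφ b x⟩, rfl⟩
  · exact fun a b => hS.eq_of_forall_sat_iff fun x => by simp [hφ, sat_sup]
  · exact fun a b => hS.eq_of_forall_sat_iff fun x => by simp [hφ, sat_inf]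
  · exact hS.eq_of_forall_sat_iff fun x => by simp [hφ, not_sat_bot]
  · refine fun a b => hS.eq_of_forall_sat_iff fun x => ?_
    simp only [hφ, sat_himp_iff]
    constructor
    · exact fun h z hz => h (g z) (hm hz)
    · intro h y hy
      obtain ⟨z, hz, rfl⟩ := hp hy
      exact h z hz

end Hom

/-- The functor sending a Gödel algebraic I-topological system to its Esakia space of points. -/
def toFESA : GITopSys.{u} ⥤ FESA.{u} where
  obj S := ⟨S.property.toEsakiaSpace, S.property.isForest_toEsakiaSpace⟩
  map {S T} f := ObjectProperty.homMk (Hom.toEsakiaHom f.hom S.property T.property)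

instance : toFESA.{u}.Faithful where
  map_injective {S T f g} h := by
    refine ObjectProperty.hom_ext _ (Hom.ext_of_f₁_eq S.property ?_)
    exact congrArg (fun k : toFESA.obj S ⟶ toFESA.obj T =>
      (show EsakiaHom _ _ from k.hom).toFun) h

instance : toFESA.{u}.Full where
  map_surjective {S T} k := by
    let g : EsakiaHom S.property.toEsakiaSpace.X T.property.toEsakiaSpace.X := k.hom
    obtain ⟨f, hf⟩ := Hom.exists_of_continuous (T := T.obj) S.property g.toFun
      g.continuous_toFun g.monotone' g.exists_map_eq_of_map_le'
    refine ⟨ObjectProperty.homMk f, ObjectProperty.hom_ext _ ?_⟩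
    exact DFunLike.coe_injective (F := EsakiaHom _ _) hf

end ITopSys

/-! ### The system of clopen up-sets of an Esakia space -/

namespace EsakiaSpace

variable (E : EsakiaSpace.{u})

instance : DistribLattice (ClopenUpperSet E.X) :=
  DistribLattice.ofInfSupLe fun U V W x => by
    change x ∈ (U : Set E.X) ∩ (V ∪ W) → x ∈ (U ∩ V : Set E.X) ∪ (U ∩ W)
    rw [Set.inter_union_distrib_left]
    exact id

/-- The clopen upper set of points all of whose successors in `U` are in `V`. -/
def himp (U V : ClopenUpperSet E.X) : ClopenUpperSet E.X where
  carrier := (lowerClosure ((U : Set E.X) \ V) : Set E.X)ᶜ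
  isClopen' := (E.isClopen_lowerClosure _ (U.isClopen.diff V.isClopen)).compl
  upper' := (lowerClosure ((U : Set E.X) \ V)).lower.compl

variable {E}

theorem mem_himp {U V : ClopenUpperSet E.X} {x : E.X} :
    x ∈ E.himp U V ↔ ∀ y, x ≤ y → y ∈ U → y ∈ V := by
  change x ∉ lowerClosure ((U : Set E.X) \ V) ↔ _
  simp only [mem_lowerClosure, Set.mem_sdiff, SetLike.mem_coe]
  grind

instance : HeytingAlgebra (ClopenUpperSet E.X) :=
  HeytingAlgebra.ofHImp E.himp fun U V W => by
    constructor
    · exact fun h x hx => mem_himp.1 (h hx.1) x le_rfl hx.2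
    · exact fun h x hx => mem_himp.2 fun y hy hyV => h ⟨U.upper hy hx, hyV⟩

theorem le_iff_forall_clopenUpperSet {x y : E.X} :
    x ≤ y ↔ ∀ U : ClopenUpperSet E.X, x ∈ U → y ∈ U := by
  refine ⟨fun h U hx => U.upper h hx, fun h => ?_⟩
  by_contra hxy
  obtain ⟨U, hU, hU', hx, hy⟩ := exists_isClopen_upper_of_not_le hxy
  exact hy (h ⟨⟨U, hU⟩, hU'⟩ hx)

variable (E)

/-- The I-topological system of points and clopen upper sets of a nonempty Esakia space. -/
def toITopSys [Nonempty E.X] : ITopSys.{u} where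
  X := E.X
  A := ClopenUpperSet E.X
  sat x U := x ∈ U
  not_sat_bot _ h := h
  sat_inf _ _ _ := Iff.rfl
  sat_sup _ _ _ := Iff.rfl
  sat_himp x U V := by
    refine mem_himp.trans (forall_congr' fun y => ?_)
    -- Priestley separation identifies the given order with the pointwise order of `p^*`.
    rw [← imp_iff_not_or, le_iff_forall_clopenUpperSet, Pi.le_def]
    refine imp_congr_left (forall_congr' fun W => ?_)
    rw [Bool.le_iff_imp]
    simp [satChar]

variable {E}

/-- If `h` disagrees with evaluation at every point, each point has a neighbourhood on which some
`U` with value 1 lies inside some `V` with value 0. Compactness makes this global, against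
monotonicity of `h`. -/
theorem exists_mem_iff_boundedLatticeHom (h : BoundedLatticeHom (ClopenUpperSet E.X) Bool) :
    ∃ x : E.X, ∀ U, x ∈ U ↔ h U = true := by
  by_contra hne
  push Not at hne
  have key : ∃ U V : ClopenUpperSet E.X, h U = true ∧ h V = false ∧
      ∀ x ∈ (Set.univ : Set E.X), x ∈ U → x ∈ V := by
    refine isCompact_univ.induction_on (p := fun s => ∃ U V : ClopenUpperSet E.X,
      h U = true ∧ h V = false ∧ ∀ x ∈ s, x ∈ U → x ∈ V) ?_ ?_ ?_ ?_
    · exact ⟨⊤, ⊥, map_top h, map_bot h, by simp⟩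
    · rintro s t hst ⟨U, V, hU, hV, H⟩
      exact ⟨U, V, hU, hV, fun x hx => H x (hst hx)⟩
    · rintro s t ⟨U, V, hU, hV, H⟩ ⟨U', V', hU', hV', H'⟩
      refine ⟨U ⊓ U', V ⊔ V', by simp [hU, hU'], by simp [hV, hV'], ?_⟩
      rintro x (hx | hx) hxU
      · exact Or.inl (H x hx hxU.1)
      · exact Or.inr (H' x hx hxU.2)
    · intro x _
      obtain ⟨U, ⟨hxU, hU⟩ | ⟨hxU, hU⟩⟩ := hne x
      · exact ⟨U, mem_nhdsWithin_of_mem_nhds (U.isClopen.2.mem_nhds hxU), ⊤, U, map_top h,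
          by simpa using hU, fun y hy _ => hy⟩
      · exact ⟨(U : Set E.X)ᶜ, mem_nhdsWithin_of_mem_nhds (U.isClopen.compl.2.mem_nhds hxU),
          U, ⊥, hU, map_bot h, fun y hy hy' => (hy hy').elim⟩
  obtain ⟨U, V, hU, hV, H⟩ := key
  have hle : h U ≤ h V := OrderHomClass.mono h fun x hx => H x trivial hx
  rw [hU, hV] at hle
  exact absurd hle (by decide)

theorem IsForest.isGodelAlgebraic_toITopSys [Nonempty E.X] (hE : E.IsForest) :
    E.toITopSys.IsGodelAlgebraic := by
  refine ⟨fun (U V : ClopenUpperSet E.X) => ?_, fun x y hxy => ?_, fun h => ?_⟩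
  · refine top_le_iff.1 fun x _ => ?_
    change x ∈ E.himp U V ∨ x ∈ E.himp V U
    by_contra! hx
    rw [mem_himp, mem_himp] at hx
    push Not at hx
    obtain ⟨⟨y, hxy, hyU, hyV⟩, z, hxz, hzV, hzU⟩ := hx
    rcases (hE.2 x).total hxy hxz with hyz | hzy
    · exact hzU (U.upper hyz hyU)
    · exact hyV (V.upper hzy hzV)
  · have hmem (U : ClopenUpperSet E.X) : E.toITopSys.sat x U ↔ E.toITopSys.sat y U :=
      (E.toITopSys.pStar_apply_eq_true x U).symm.trans
        (hxy ▸ E.toITopSys.pStar_apply_eq_true y U)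
    exact le_antisymm (α := E.X) (le_iff_forall_clopenUpperSet.2 fun U => (hmem U).1)
      (le_iff_forall_clopenUpperSet.2 fun U => (hmem U).2)
  · obtain ⟨x, hx⟩ := exists_mem_iff_boundedLatticeHom (E := E) h
    refine ⟨x, DFunLike.ext _ _ fun U => ?_⟩
    exact Bool.eq_iff_iff.2 ((E.toITopSys.pStar_apply_eq_true x U).trans (hx U))

theorem toITopSys_le_iff [Nonempty E.X] {x y : E.X} :
    @LE.le E.toITopSys.X _ x y ↔ x ≤ y :=
  ITopSys.le_iff_sat.trans le_iff_forall_clopenUpperSet.symm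

/-- An order isomorphism of Esakia spaces continuous in one direction is an isomorphism. -/
def isoOfOrderIso {E F : EsakiaSpace.{u}} (e : E.X ≃o F.X) (he : Continuous e) : E ≅ F where
  hom := show EsakiaHom E.X F.X from
    { toFun := e
      monotone' := e.monotone
      continuous_toFun := he
      exists_map_eq_of_map_le' := fun _ y h =>
        ⟨e.symm y, e.le_symm_apply.2 h, e.apply_symm_apply y⟩ }
  inv := show EsakiaHom F.X E.X from
    { toFun := e.symm
      monotone' := e.symm.monotone
      continuous_toFun := he.continuous_symm_of_equiv_compact_to_t2 (f := e.toEquiv)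
      exists_map_eq_of_map_le' := fun _ y h =>
        ⟨e y, e.symm_apply_le.1 h, e.symm_apply_apply y⟩ }
  hom_inv_id := DFunLike.ext (F := EsakiaHom E.X E.X) _ _ e.symm_apply_apply
  inv_hom_id := DFunLike.ext (F := EsakiaHom F.X F.X) _ _ e.apply_symm_apply

/-- A nonempty Esakia space whose order is a forest is the space of points of its I-topological
system. -/
def IsForest.isoToEsakiaSpace [Nonempty E.X] (hE : E.IsForest) :
    E ≅ hE.isGodelAlgebraic_toITopSys.toEsakiaSpace :=
  isoOfOrderIso (F := hE.isGodelAlgebraic_toITopSys.toEsakiaSpace)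
    { Equiv.refl E.X with map_rel_iff' := toITopSys_le_iff } <| by
    -- Each coordinate of `p^*` is the indicator of a clopen set.
    refine continuous_induced_rng.2 (continuous_pi fun U => ?_)
    refine continuous_discrete_rng.2 fun b => ?_
    have hU : IsClopen (SetLike.coe (show ClopenUpperSet E.X from U)) :=
      ClopenUpperSet.isClopen _
    cases b
    · convert hU.compl.2 using 1
      ext x
      exact @decide_eq_false_iff_not _ (Classical.propDecidable _)
    · convert hU.2 using 1
      ext x
      exact @decide_eq_true_iff _ (Classical.propDecidable _)

end EsakiaSpace

instance : ITopSys.toFESA.{u}.EssSurj where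
  mem_essImage E := by
    have : Nonempty E.obj.X := E.property.1
    exact ⟨⟨E.obj.toITopSys, E.property.isGodelAlgebraic_toITopSys⟩,
      ⟨ObjectProperty.isoMk _ E.property.isoToEsakiaSpace.symm⟩⟩

end

theorem mainTheorem4 : Nonempty (GITopSys.{u} ≌ FESA.{u}) := by
  have : ITopSys.toFESA.{u}.IsEquivalence := {}
  exact ⟨ITopSys.toFESA.asEquivalence⟩
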